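/- Let $k\ge 0$. All maps are continuous. Let $U\subseteq\mathbb R^k$ be open and $y\in\mathbb R^k$. A triple $(f,U,y)$ is \emph{admissible} if $f$ is an $\mathbb R^k$-valued map defined at least on $\overline U$, $f$ is proper on $\overline U$ (that is, $f^{-1}(K)\cap\overline U$ is compact for every compact $K\subseteq\mathbb R^k$), and $f(x)\neq y$ for all $x\in\partial U$. It is \emph{regular} if, moreover, $f$ is $C^\infty$ on $\overline U$ (that is, it has a $C^\infty$ extension to an open neighbourhood of $\overline U$) and $f'(x)$ is onto for every $x\in f^{-1}(y)\cap U$; its degree is then $$\deg(f,U,y)=\sum_{x\in f^{-1}(y)\cap U}\operatorname{sign}\det f'(x),$$ a finite sum. The degree of an admissible triple $(f,U,y)$ is $\deg(g,U,z)$, where $(g,U,z)$ is any regular triple such that, for some $\epsilon,\sigma>0$ with $\epsilon+\sigma<\operatorname{dist}(y,f(\partial U))$ (where $\operatorname{dist}(y,\emptyset)=+\infty$), one has $|f(x)-g(x)|\le\epsilon$ for all $x\in\overline U$ and $|z-y|\le\sigma$. A triple $(f,U,y)$ is \emph{weakly admissible} if $f$ is an $\mathbb R^k$-valued map defined at least on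 $U$ and $f^{-1}(y)\cap U$ is compact. Its Brouwer degree is $\deg(f,U,y):=\deg(f,V,y)$, where $V$ is any bounded open neighbourhood of $f^{-1}(y)\cap U$ such that $\overline V\subseteq U$; the triple $(f,V,y)$ is then admissible. If $H$ is an $\mathbb R^k$-valued map defined at least on $U\times[0,1]$ and $\alpha:[0,1]\to\mathbb R^k$ is a path, then $(H,U,\alpha)$ is a \emph{weakly admissible homotopy of triples} if the set $\{(x,\lambda)\in U\times[0,1]: H(x,\lambda)=\alpha(\lambda)\}$ is compact. \textbf{Theorem.} The Brouwer degree for weakly admissible triples is well defined (the required $V$, and for each of them the required $(g,V,z)$, exist, and the resulting integer does not depend on their choice), and it satisfies the following three fundamental properties: (Normalization) $\deg(I,\mathbb R^k,0)=1$, where $I$ denotes the identity on $\mathbb R^k$; (Additivity) if $(f,U,y)$ is weakly admissible, and $U_1$ and $U_2$ are two disjoint open subsets of $U$ such that $f^{-1}(y)\cap U\subseteq U_1\cup U_2$, then $(f,U_1,y)$ and $(f,U_2,y)$ are weakly admissible and $$\deg(f,U,y)=\deg(f,U_1,y)+\deg(f,U_2,y);$$ (Homotopy Invariance) if $(H,U,\alpha)$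 is a weakly admissible homotopy of triples, then $(H(\cdot,0),U,\alpha(0))$ and $(H(\cdot,1),U,\alpha(1))$ are weakly admissible and $$\deg(H(\cdot,0),U,\alpha(0))=\deg(H(\cdot,1),U,\alpha(1)).$$ -/

import Mathlib

open Set Topology
open scoped ContDiff

noncomputable section

namespace BrouwerDegree

/-- The Euclidean space `ℝ^k`. -/
abbrev Euc (k : ℕ) : Type := EuclideanSpace ℝ (Fin k)

variable {k : ℕ}

/-- `f`, defined at least on the closure of the open set `U`, is continuous and proper on
`closure U`, and `f x ≠ y` for all `x` in the boundary of `U`. -/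
structure Admissible (f : Euc k → Euc k) (U : Set (Euc k)) (y : Euc k) : Prop where
  isOpen : IsOpen U
  continuousOn : ContinuousOn f (closure U)
  proper : ∀ K : Set (Euc k), IsCompact K → IsCompact (closure U ∩ f ⁻¹' K)
  ne_of_mem_frontier : ∀ x ∈ frontier U, f x ≠ y

/-- `f` is `C^∞` on the (arbitrary) set `X`: it admits a `C^∞` extension to an open
neighbourhood of `X`. -/
def SmoothOn (f : Euc k → Euc k) (X : Set (Euc k)) : Prop :=
  ∃ (W : Set (Euc k)) (F : Euc k → Euc k),
    IsOpen W ∧ X ⊆ W ∧ ContDiffOn ℝ ∞ F W ∧ EqOn f F X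

/-- An admissible triple is regular if `f` is `C^∞` on `closure U` and every solution `x ∈ U` of
`f x = y` is a regular point, that is, the derivative of `f` at `x` is onto. -/
structure RegularTriple (f : Euc k → Euc k) (U : Set (Euc k)) (y : Euc k) : Prop where
  admissible : Admissible f U y
  smooth : SmoothOn f (closure U)
  regular : ∀ x ∈ U, f x = y → Function.Surjective (fderiv ℝ f x)

/-- The index of `f` at `x`: the sign of the Jacobian determinant. -/
def index (f : Euc k → Euc k) (x : Euc k) : ℤ :=
  (SignType.sign (fderiv ℝ f x).det : ℤ)

/-- The degree of a regular triple: the sum of the indices of the (finitely many) solutions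
`x ∈ U` of `f x = y`. -/
def regularDegree (f : Euc k → Euc k) (U : Set (Euc k)) (y : Euc k) : ℤ :=
  ∑ᶠ x ∈ U ∩ f ⁻¹' {y}, index f x

/-- `(g, U, z)` is a regular triple which approximates `(f, U, y)`: `g` is `ε`-close to `f` on
`closure U`, `z` is `σ`-close to `y`, and `ε + σ < dist (y, f (∂U))`, where the distance to the
empty set is `+∞`. -/
def Approximates (g : Euc k → Euc k) (z : Euc k)
    (f : Euc k → Euc k) (U : Set (Euc k)) (y : Euc k) : Prop :=
  RegularTriple g U z ∧
    ∃ ε σ : ℝ, 0 < ε ∧ 0 < σ ∧ (∀ x ∈ closure U, ‖f x - g x‖ ≤ ε) ∧ ‖z - y‖ ≤ σ ∧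
      ENNReal.ofReal (ε + σ) < Metric.infEDist y (f '' frontier U)

/-- The degree of an admissible triple `(f, U, y)`: the degree of any regular triple which
approximates it. -/
def admissibleDegree (f : Euc k → Euc k) (U : Set (Euc k)) (y : Euc k) : ℤ :=
  Classical.epsilon fun d : ℤ => ∃ g z, Approximates g z f U y ∧ d = regularDegree g U z

/-- `f`, defined at least on the open set `U`, is continuous on `U`, and `f⁻¹(y) ∩ U` is
compact. -/
structure WeaklyAdmissible (f : Euc k → Euc k) (U : Set (Euc k)) (y : Euc k) : Prop where
  isOpen : IsOpen U
  continuousOn : ContinuousOn f U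
  isCompact : IsCompact (U ∩ f ⁻¹' {y})

/-- `V` is a bounded open neighbourhood of `f⁻¹(y) ∩ U` whose closure is contained in `U`. -/
structure IsolatingNhd (f : Euc k → Euc k) (U : Set (Euc k)) (y : Euc k)
    (V : Set (Euc k)) : Prop where
  isOpen : IsOpen V
  isBounded : Bornology.IsBounded V
  subset : U ∩ f ⁻¹' {y} ⊆ V
  closure_subset : closure V ⊆ U

/-- The Brouwer degree of a weakly admissible triple `(f, U, y)`: the degree of the admissible
triple `(f, V, y)`, for any bounded open neighbourhood `V` of `f⁻¹(y) ∩ U` with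
`closure V ⊆ U`. -/
def degree (f : Euc k → Euc k) (U : Set (Euc k)) (y : Euc k) : ℤ :=
  Classical.epsilon fun d : ℤ => ∃ V, IsolatingNhd f U y V ∧ d = admissibleDegree f V y

/-- `(H, U, α)` is a weakly admissible homotopy of triples: `U` is open, `H` and `α` are
continuous on `U × [0,1]` and `[0,1]`, and the set of all `(x, t) ∈ U × [0,1]` with
`H (x, t) = α t` is compact. -/
structure WeaklyAdmissibleHomotopy (H : Euc k × ℝ → Euc k) (U : Set (Euc k))
    (α : ℝ → Euc k) : Prop where
  isOpen : IsOpen U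
  continuousOn : ContinuousOn H (U ×ˢ Icc (0 : ℝ) 1)
  continuousOn_path : ContinuousOn α (Icc (0 : ℝ) 1)
  isCompact : IsCompact {p : Euc k × ℝ | p ∈ U ×ˢ Icc (0 : ℝ) 1 ∧ H p = α p.2}

end BrouwerDegree

end

/-! The degree is an integral. Let `V` be bounded and open, `G` smooth without zeros on the frontier
of `V` and with only regular zeros in `V`. If `φ` is supported close enough to 0, changing variables
near each zero shows that the integral of `φ(G) · det G'` over `V` is the sum of the indices times
the integral of `φ` (`exists_setIntegral_eq`). This integral is constant along an affine homotopy
that keeps the frontier away from the support of `φ`: by Cramer's rule and the symmetry of second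
derivatives, the time derivative of the density is a divergence, which a cutoff makes compactly
supported (`setIntegral_density_eq`). Hence the regular degree is invariant along affine homotopies
without zeros on the frontier (`regularDegree_zero_eq`).

Two approximations of one admissible triple are joined by such a homotopy, because balls are convex.
Approximations exist by Tietze extension, smoothing and Sard's theorem. So the degree is well
defined on bounded sets.

The remaining properties come from sharing one approximation among several triples. Sharing it among
open subsets gives additivity, hence excision and independence of the isolating neighbourhood.
Sharing it among nearby parameters makes the degree along a homotopy locally constant, hence
constant on `[0,1]`. -/

noncomputable section

namespace BrouwerDegree

/-! ### Determinant identities behind the divergence formula. -/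

section Algebra

variable {ι E : Type*} [Fintype ι] [DecidableEq ι] [NormedAddCommGroup E] [NormedSpace ℝ E]

/-- The determinant with respect to a basis, as a continuous alternating map. -/
def detForm (b : Module.Basis ι ℝ E) : E [⋀^ι]→L[ℝ] ℝ :=
  { b.det with
    cont := by
      have : FiniteDimensional ℝ E := b.finiteDimensional_of_finite
      change Continuous fun v : ι → E => b.det v
      simp only [Module.Basis.det_apply]
      refine Continuous.matrix_det (continuous_matrix fun i j => ?_)
      have h : Continuous fun x : E => b.coord i x :=
        LinearMap.continuous_of_finiteDimensional (b.coord i)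
      exact h.comp (continuous_apply j) }

theorem detForm_apply (b : Module.Basis ι ℝ E) (v : ι → E) : detForm b v = b.det v := rfl

theorem detForm_comp (b : Module.Basis ι ℝ E) (f : E →L[ℝ] E) :
    detForm b (fun i => f (b i)) = f.det := by
  have := b.det_comp (f : E →ₗ[ℝ] E) b
  rw [b.det_self, mul_one] at this
  exact this

/-- Cramer's rule. -/
theorem sum_det_update_smul (b : Module.Basis ι ℝ E) (A : ι → E) (w : E) :
    ∑ j, b.det (Function.update A j w) • A j = b.det A • w := by
  apply b.repr.injective
  ext r
  have h := congrFun (Matrix.mulVec_cramer (b.toMatrix A) (b.repr w)) r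
  simp only [Matrix.mulVec, dotProduct, Matrix.cramer_apply, Pi.smul_apply, smul_eq_mul] at h
  simp only [map_sum, map_smul, Finsupp.coe_finsetSum, Finset.sum_apply, Finsupp.smul_apply,
    smul_eq_mul, Module.Basis.det_apply, Module.Basis.toMatrix_update]
  rw [← h]
  refine Finset.sum_congr rfl fun j _ => ?_
  rw [Module.Basis.toMatrix_apply, mul_comm]

/-- Exchanging `i` and `j` swaps two entries of the tuple, so by the symmetry of `B` the summand is
antisymmetric. With `B` the second derivatives of a map, this is why they drop out of the
divergence. -/
theorem sum_sum_det_update_update_eq_zero (D : E [⋀^ι]→L[ℝ] ℝ) (A : ι → E) (w : E)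
    (B : ι → ι → E) (hB : ∀ i j, B i j = B j i) :
    ∑ j, ∑ i, (if i = j then 0 else
      D (Function.update (Function.update A j w) i (B j i))) = 0 := by
  set a : ι → ι → ℝ := fun j i => if i = j then 0 else
    D (Function.update (Function.update A j w) i (B j i)) with ha
  have hanti : ∀ i j, a j i = - a i j := by
    intro i j
    by_cases h : i = j
    · simp [ha, h]
    · simp only [ha, h, Ne.symm h, if_false]
      refine Eq.trans ?_ (D.toAlternatingMap.map_swap
        (Function.update (Function.update A i w) j (B i j)) h)
      refine congrArg D ?_
      ext l
      simp only [Function.comp_apply]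
      by_cases hi : l = i
      · subst hi; simp [hB]
      by_cases hj : l = j
      · subst hj; simp [h, Ne.symm h]
      simp [Equiv.swap_apply_of_ne_of_ne hi hj, hi, hj]
  have h1 : ∑ j, ∑ i, a j i = - ∑ j, ∑ i, a j i := by
    conv_rhs => rw [Finset.sum_comm]
    simp only [← Finset.sum_neg_distrib]
    exact Finset.sum_congr rfl fun j _ => Finset.sum_congr rfl fun i _ => hanti i j
  linarith

/-- The pointwise algebra of `sum_fderiv_field`: `A`, `W` and `B` stand for the first derivatives of
`f`, those of `w` and the second derivatives of `f`, `l` for the derivative of `φ` and `c` for its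
value. Cramer's rule gives the `l` term. -/
theorem sum_divergence_eq (b : Module.Basis ι ℝ E) (A W : ι → E) (w : E) (B : ι → ι → E)
    (hB : ∀ i j, B i j = B j i) (l : E →L[ℝ] ℝ) (c : ℝ) :
    ∑ j, (l (A j) * detForm b (Function.update A j w) +
      c * ∑ i, detForm b (Function.update (Function.update A j w) i (if i = j then W j else B j i)))
      = l w * detForm b A + c * ∑ j, detForm b (Function.update A j (W j)) := by
  rw [Finset.sum_add_distrib, ← Finset.mul_sum]
  congr 1
  · have := congrArg l (sum_det_update_smul b A w)
    simp only [map_sum, map_smul, smul_eq_mul] at this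
    simp only [detForm_apply]
    rw [mul_comm (l w), ← this]
    exact Finset.sum_congr rfl fun j _ => mul_comm _ _
  · congr 1
    have h0 := sum_sum_det_update_update_eq_zero (detForm b) A w B hB
    -- The vanishing off-diagonal sum is added on the right, so that both sides agree once the
    -- diagonal term `i = j` is split off.
    rw [← add_zero (∑ j, detForm b (Function.update A j (W j))), ← h0, ← Finset.sum_add_distrib]
    refine Finset.sum_congr rfl fun j _ => ?_
    rw [← Finset.add_sum_erase _ _ (Finset.mem_univ j),
      ← Finset.add_sum_erase _ (fun i => if i = j then (0:ℝ) else _) (Finset.mem_univ j)]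
    simp only [if_true, Function.update_idem, zero_add]
    congr 1
    refine Finset.sum_congr rfl fun i hi => ?_
    simp [Finset.ne_of_mem_erase hi]

theorem hasFDerivAt_alternating {F : Type*} [NormedAddCommGroup F] [NormedSpace ℝ F]
    (D : E [⋀^ι]→L[ℝ] ℝ) {v : ι → F → E} {v' : ι → F →L[ℝ] E} {x : F}
    (h : ∀ i, HasFDerivAt (v i) (v' i) x) :
    HasFDerivAt (fun x => D fun i => v i x)
      ((D.toContinuousMultilinearMap.linearDeriv fun i => v i x).comp
        (ContinuousLinearMap.pi v')) x :=
  (D.hasFDerivAt fun i => v i x).comp x (hasFDerivAt_pi.2 h)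

end Algebra

/-! ### Invariance of the degree integral along affine homotopies. -/

section Homotopy

open MeasureTheory

variable {ι E : Type*} [Fintype ι] [DecidableEq ι] [NormedAddCommGroup E] [NormedSpace ℝ E]

theorem fderiv_add_const_smul {g w : E → E} (hg : ContDiff ℝ ∞ g) (hw : ContDiff ℝ ∞ w)
    (t : ℝ) (x : E) :
    fderiv ℝ (fun x => g x + t • w x) x = fderiv ℝ g x + t • fderiv ℝ w x := by
  have h1 := (hg.differentiable (by simp)) x
  have h2 := (hw.differentiable (by simp)) x
  rw [← (h1.hasFDerivAt.add (h2.hasFDerivAt.const_smul t)).fderiv]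
  rfl

/-- The time derivative of the pulled back density along an affine homotopy. -/
theorem hasDerivAt_density (b : Module.Basis ι ℝ E) {g w : E → E} (hg : ContDiff ℝ ∞ g)
    (hw : ContDiff ℝ ∞ w) {φ : E → ℝ} (hφ : ContDiff ℝ ∞ φ) (x : E) (t : ℝ) :
    HasDerivAt (fun t : ℝ => φ (g x + t • w x) *
        detForm b (fun i => fderiv ℝ (fun x => g x + t • w x) x (b i)))
      (fderiv ℝ φ (g x + t • w x) (w x) *
          detForm b (fun i => fderiv ℝ (fun x => g x + t • w x) x (b i)) +
        φ (g x + t • w x) * ∑ j, detForm b (Function.update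
          (fun i => fderiv ℝ (fun x => g x + t • w x) x (b i)) j (fderiv ℝ w x (b j)))) t := by
  simp only [fderiv_add_const_smul hg hw]
  have h1 : HasDerivAt (fun t : ℝ => g x + t • w x) (w x) t := by
    simpa using ((hasDerivAt_id t).smul_const (w x)).const_add (g x)
  have h2 := ((hφ.differentiable (by simp)) (g x + t • w x)).hasFDerivAt.comp_hasDerivAt t h1
  have h3 : ∀ i, HasFDerivAt (fun t : ℝ => (fderiv ℝ g x + t • fderiv ℝ w x) (b i))
      (ContinuousLinearMap.toSpanSingleton ℝ (fderiv ℝ w x (b i))) t := by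
    intro i
    have : HasDerivAt (fun t : ℝ => (fderiv ℝ g x + t • fderiv ℝ w x) (b i))
        (fderiv ℝ w x (b i)) t := by
      simpa using ((hasDerivAt_id t).smul_const (fderiv ℝ w x (b i))).const_add
        (fderiv ℝ g x (b i))
    exact this.hasFDerivAt
  have h4 := (hasFDerivAt_alternating (detForm b) h3).hasDerivAt
  refine (h2.mul h4).congr_deriv ?_
  simp [ContinuousMultilinearMap.linearDeriv_apply]

/-- The divergence of the vector field whose `j`-th component is
`ψ · φ(f) · det(∂₁f, …, w, …, ∂ₖf)`, with `w` in position `j`, where `φ ∘ f` vanishes wherever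
`ψ` is not stationary. -/
theorem sum_fderiv_field (b : Module.Basis ι ℝ E) {f w : E → E} (hf : ContDiff ℝ ∞ f)
    (hw : ContDiff ℝ ∞ w) {φ ψ : E → ℝ} (hφ : ContDiff ℝ ∞ φ) (hψ : ContDiff ℝ ∞ ψ) (x : E)
    (h0 : fderiv ℝ ψ x = 0 ∨ φ (f x) = 0) :
    ∑ j, fderiv ℝ (fun x => ψ x * (φ (f x) * detForm b
      (Function.update (fun i => fderiv ℝ f x (b i)) j (w x)))) x (b j) =
    ψ x * (fderiv ℝ φ (f x) (w x) * detForm b (fun i => fderiv ℝ f x (b i)) +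
      φ (f x) * ∑ j, detForm b (Function.update (fun i => fderiv ℝ f x (b i)) j
        (fderiv ℝ w x (b j)))) := by
  have hf' : ContDiff ℝ ∞ (fderiv ℝ f) := hf.fderiv_right (by simp)
  have hsymm : IsSymmSndFDerivAt ℝ f x := hf.contDiffAt.isSymmSndFDerivAt (by
    simpa using WithTop.coe_le_coe.2 (le_top : (2 : ℕ∞) ≤ ⊤))
  rw [← sum_divergence_eq b (fun i => fderiv ℝ f x (b i)) (fun j => fderiv ℝ w x (b j)) (w x)
    (fun j i => fderiv ℝ (fderiv ℝ f) x (b j) (b i)) (fun i j => hsymm _ _), Finset.mul_sum]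
  refine Finset.sum_congr rfl fun j _ => ?_
  have h1 : ∀ i, HasFDerivAt (fun x => Function.update (fun i => fderiv ℝ f x (b i)) j (w x) i)
      (if i = j then fderiv ℝ w x else (fderiv ℝ (fderiv ℝ f) x).flip (b i)) x := by
    intro i
    by_cases h : i = j
    · subst h
      simpa using ((hw.differentiable (by simp)) x).hasFDerivAt
    · simp only [h, if_false, ne_eq, not_false_eq_true, Function.update_of_ne]
      have := ((hf'.differentiable (by simp)) x).hasFDerivAt.clm_apply
        (hasFDerivAt_const (b i) x)
      simpa using this
  have h2 := hasFDerivAt_alternating (detForm b) h1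
  have h3 := ((hφ.differentiable (by simp)) (f x)).hasFDerivAt.comp x
    ((hf.differentiable (by simp)) x).hasFDerivAt
  have h4 := ((hψ.differentiable (by simp)) x).hasFDerivAt.mul (h3.mul h2)
  have h5 := h4.fderiv
  simp only [Function.comp_apply] at h5
  refine (congrArg (fun L : E →L[ℝ] ℝ => L (b j)) h5).trans ?_
  -- The product rule's only unwanted term, the one differentiating the cutoff, vanishes by `h0`.
  have h6 : φ (f x) * fderiv ℝ ψ x (b j) = 0 := by rcases h0 with h | h <;> simp [h]
  have h7 : ∀ i, (if i = j then fderiv ℝ w x else (fderiv ℝ (fderiv ℝ f) x).flip (b i)) (b j) =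
      if i = j then fderiv ℝ w x (b j) else fderiv ℝ (fderiv ℝ f) x (b j) (b i) := by
    intro i; split_ifs <;> rfl
  simp [ContinuousMultilinearMap.linearDeriv_apply, h7]
  linear_combination (detForm b (Function.update (fun i => fderiv ℝ f x (b i)) j (w x))) * h6

theorem contDiff_field (b : Module.Basis ι ℝ E) {f w : E → E} (hf : ContDiff ℝ ∞ f)
    (hw : ContDiff ℝ ∞ w) {φ ψ : E → ℝ} (hφ : ContDiff ℝ ∞ φ) (hψ : ContDiff ℝ ∞ ψ) (j : ι) :
    ContDiff ℝ 1 (fun x => ψ x * (φ (f x) * detForm b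
      (Function.update (fun i => fderiv ℝ f x (b i)) j (w x)))) := by
  have hf' : ContDiff ℝ ∞ (fderiv ℝ f) := hf.fderiv_right (by simp)
  have h1 : ContDiff ℝ ∞ fun x => Function.update (fun i => fderiv ℝ f x (b i)) j (w x) := by
    rw [contDiff_pi]
    intro i
    by_cases h : i = j
    · subst h; simpa using hw
    · simp only [h, ne_eq, not_false_eq_true, Function.update_of_ne]
      exact hf'.clm_apply contDiff_const
  have h2 : ContDiff ℝ ∞ fun x => detForm b
      (Function.update (fun i => fderiv ℝ f x (b i)) j (w x)) :=
    (detForm b).toContinuousMultilinearMap.contDiff.comp h1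
  exact (hψ.mul ((hφ.comp hf).mul h2)).of_le (by simp)

variable [FiniteDimensional ℝ E] [MeasurableSpace E] [BorelSpace E] (μ : Measure E)
  [μ.IsAddHaarMeasure]

/-- Integration by parts against the constant 1. -/
theorem integral_fderiv_eq_zero {X : E → ℝ} (hX : ContDiff ℝ 1 X) (hc : HasCompactSupport X)
    (v : E) : ∫ x, fderiv ℝ X x v ∂μ = 0 := by
  have h := integral_mul_fderiv_eq_neg_fderiv_mul_of_integrable (𝕜 := ℝ) (μ := μ)
    (f := fun _ : E => (1 : ℝ)) (g := X) (v := v) (by simp) (by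
      simp only [one_mul]
      refine Continuous.integrable_of_hasCompactSupport ?_ (hc.fderiv_apply ℝ v)
      exact (hX.continuous_fderiv (by simp)).clm_apply continuous_const) (by
      simpa using hX.continuous.integrable_of_hasCompactSupport hc)
      (fun x _ => differentiableAt_const _) (fun x _ => (hX.differentiable (by simp)) x)
  simpa using h

/-- The integral of the localized pulled back density is invariant along affine homotopies. -/
theorem integral_density_eq (b : Module.Basis ι ℝ E) {g w : E → E} (hg : ContDiff ℝ ∞ g)
    (hw : ContDiff ℝ ∞ w) {φ ψ : E → ℝ} (hφ : ContDiff ℝ ∞ φ) (hψ : ContDiff ℝ ∞ ψ)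
    (hc : HasCompactSupport ψ)
    (h0 : ∀ t ∈ Icc (0 : ℝ) 1, ∀ x, fderiv ℝ ψ x = 0 ∨ φ (g x + t • w x) = 0) :
    ∫ x, ψ x * (φ (g x) * (fderiv ℝ g x).det) ∂μ =
      ∫ x, ψ x * (φ (g x + w x) * (fderiv ℝ (fun x => g x + w x) x).det) ∂μ := by
  set A : ℝ → E → ι → E := fun t x i => fderiv ℝ (fun x => g x + t • w x) x (b i) with hA
  set G : ℝ → E → ℝ := fun t x => ψ x * (fderiv ℝ φ (g x + t • w x) (w x) * detForm b (A t x) +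
    φ (g x + t • w x) * ∑ j, detForm b (Function.update (A t x) j (fderiv ℝ w x (b j)))) with hG
  have hg' : Continuous (fderiv ℝ g) := hg.continuous_fderiv (by simp)
  have hw' : Continuous (fderiv ℝ w) := hw.continuous_fderiv (by simp)
  have hφ' : Continuous (fderiv ℝ φ) := hφ.continuous_fderiv (by simp)
  have hAc : Continuous fun p : ℝ × E => A p.1 p.2 := by
    refine continuous_pi fun i => ?_
    simp only [hA, fderiv_add_const_smul hg hw]
    exact ((hg'.comp continuous_snd).add (continuous_fst.smul (hw'.comp continuous_snd))).clm_apply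
      continuous_const
  have hgc := hg.continuous
  have hwc := hw.continuous
  have hφc := hφ.continuous
  have hψc := hψ.continuous
  have hGc : Continuous (Function.uncurry G) := by
    have hD := (detForm b).cont
    have hhc : Continuous fun p : ℝ × E => g p.2 + p.1 • w p.2 := by fun_prop
    refine (hψc.comp continuous_snd).mul (Continuous.add (Continuous.mul ?_ (hD.comp hAc))
      ((hφc.comp hhc).mul (continuous_finsetSum _ fun j _ => hD.comp ?_)))
    · exact (hφ'.comp hhc).clm_apply (hwc.comp continuous_snd)
    · exact hAc.update j ((hw'.comp continuous_snd).clm_apply continuous_const)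
  have hderiv : ∀ x t, HasDerivAt (fun t : ℝ => ψ x * (φ (g x + t • w x) * detForm b (A t x)))
      (G t x) t := fun x t => (hasDerivAt_density b hg hw hφ x t).const_mul (ψ x)
  have hftc : ∀ x, ∫ t in (0 : ℝ)..1, G t x =
      ψ x * (φ (g x + w x) * (fderiv ℝ (fun x => g x + w x) x).det) -
      ψ x * (φ (g x) * (fderiv ℝ g x).det) := by
    intro x
    have hi : IntervalIntegrable (fun t => G t x) volume 0 1 :=
      (hGc.comp (continuous_id.prodMk continuous_const)).intervalIntegrable _ _
    rw [intervalIntegral.integral_eq_sub_of_hasDerivAt (fun t _ => hderiv x t) hi]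
    simp [hA, detForm_comp]
  have hzero : ∀ t ∈ Icc (0 : ℝ) 1, ∫ x, G t x ∂μ = 0 := by
    intro t ht
    have hft : ContDiff ℝ ∞ fun x => g x + t • w x := hg.add (contDiff_const.smul hw)
    have : ∀ x, G t x = _ := fun x => (sum_fderiv_field b hft hw hφ hψ x (h0 t ht x)).symm
    simp_rw [this]
    have hX := fun j => contDiff_field b hft hw hφ hψ j
    have hXc : ∀ j, HasCompactSupport (fun x => ψ x * (φ (g x + t • w x) * detForm b
      (Function.update (fun i => fderiv ℝ (fun x => g x + t • w x) x (b i)) j (w x)))) :=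
      fun j => hc.mul_right
    rw [integral_finsetSum]
    · exact Finset.sum_eq_zero fun j _ => integral_fderiv_eq_zero μ (hX j) (hXc j) _
    · intro j _
      exact Continuous.integrable_of_hasCompactSupport
        (((hX j).continuous_fderiv (by simp)).clm_apply continuous_const)
        ((hXc j).fderiv_apply ℝ _)
  have hint : Integrable (Function.uncurry G) ((volume.restrict (uIoc (0:ℝ) 1)).prod μ) := by
    have hK : IsCompact (Icc (0:ℝ) 1 ×ˢ tsupport ψ) := isCompact_Icc.prod hc
    have h1 : IntegrableOn (Function.uncurry G) (uIoc (0:ℝ) 1 ×ˢ tsupport ψ)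
        ((volume : Measure ℝ).prod μ) :=
      (hGc.continuousOn.integrableOn_compact hK).mono_set
        (prod_mono_left (by rw [uIoc_of_le zero_le_one]; exact Ioc_subset_Icc_self))
    have h2 : IntegrableOn (Function.uncurry G) (uIoc (0:ℝ) 1 ×ˢ univ)
        ((volume : Measure ℝ).prod μ) := by
      refine h1.of_forall_sdiff_eq_zero (measurableSet_uIoc.prod MeasurableSet.univ) ?_
      rintro ⟨t, x⟩ ⟨hx1, hx2⟩
      have : x ∉ tsupport ψ := fun h => hx2 ⟨hx1.1, h⟩
      simp [hG, image_eq_zero_of_notMem_tsupport this]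
    rwa [IntegrableOn, ← Measure.prod_restrict, Measure.restrict_univ] at h2
  -- Fubini: integrating `G` over `t` first gives the difference of the two densities (`hftc`);
  -- integrating over `x` first gives 0 (`hzero`).
  have hswap := intervalIntegral_integral_swap hint
  rw [intervalIntegral.integral_congr (g := fun _ => (0:ℝ))
    (fun t ht => hzero t (by rwa [uIcc_of_le zero_le_one] at ht))] at hswap
  simp only [intervalIntegral.integral_zero, hftc] at hswap
  have hdens : ∀ f : E → E, ContDiff ℝ ∞ f →
      Integrable (fun x => ψ x * (φ (f x) * (fderiv ℝ f x).det)) μ := by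
    intro f hf
    refine Continuous.integrable_of_hasCompactSupport ?_ hc.mul_right
    simp only [← detForm_comp b]
    refine hψc.mul ((hφc.comp hf.continuous).mul ((detForm b).cont.comp ?_))
    exact continuous_pi fun i => (hf.continuous_fderiv (by simp)).clm_apply continuous_const
  rw [integral_sub (hdens _ (hg.add hw)) (hdens _ hg)] at hswap
  linarith

/-- The degree integral is invariant along affine homotopies without zeros near the boundary. -/
theorem setIntegral_density_eq {g₀ g₁ : E → E} (hg₀ : ContDiff ℝ ∞ g₀)
    (hg₁ : ContDiff ℝ ∞ g₁) {V : Set E} (hV : IsOpen V) (hVb : Bornology.IsBounded V) {r : ℝ}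
    (hr : ∀ t ∈ Icc (0 : ℝ) 1, ∀ x ∈ frontier V, r < ‖g₀ x + t • (g₁ x - g₀ x)‖)
    {φ : E → ℝ} (hφ : ContDiff ℝ ∞ φ) (hφr : ∀ y, r < ‖y‖ → φ y = 0) :
    ∫ x in V, φ (g₀ x) * (fderiv ℝ g₀ x).det ∂μ =
      ∫ x in V, φ (g₁ x) * (fderiv ℝ g₁ x).det ∂μ := by
  have hVc : IsCompact (closure V) := hVb.isCompact_closure
  set h : ℝ × E → E := fun p => g₀ p.2 + p.1 • (g₁ p.2 - g₀ p.2) with hh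
  have hhc : Continuous h := by
    have := hg₀.continuous
    have := hg₁.continuous
    fun_prop
  -- `K` holds the points that the homotopy sends, at some time, into the closed ball of radius `r`.
  -- It is compact and misses the frontier by `hr`, so a cutoff equal to 1 near `K` and supported in
  -- `V` changes no integral.
  set K : Set E := Prod.snd '' ((Icc (0 : ℝ) 1 ×ˢ closure V) ∩ {p | ‖h p‖ ≤ r}) with hK
  have hKc : IsCompact K := by
    refine IsCompact.image ?_ continuous_snd
    exact (isCompact_Icc.prod hVc).inter_right (isClosed_le hhc.norm continuous_const)
  have hKV : K ⊆ V := by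
    rintro _ ⟨⟨t, x⟩, ⟨⟨ht, hx⟩, hle⟩, rfl⟩
    by_contra hxV
    have : x ∈ frontier V := by rw [hV.frontier_eq]; exact ⟨hx, hxV⟩
    exact absurd hle (not_le.2 (hr t ht x this))
  obtain ⟨L, hL, hKL, hLV⟩ := exists_compact_between hKc hV hKV
  obtain ⟨ψ, hψ1, hψ0, -⟩ := exists_contMDiffMap_one_nhds_of_subset_interior
    (n := ⊤) (modelWithCornersSelf ℝ E) hKc.isClosed hKL
  have hψ : ContDiff ℝ ∞ ψ := ψ.contMDiff.contDiff
  have hsub : tsupport ψ ⊆ L := by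
    refine closure_minimal (fun x hx => ?_) hL.isClosed
    by_contra h; exact hx (hψ0 x h)
  have hc : HasCompactSupport ψ := hL.of_isClosed_subset (isClosed_tsupport _) hsub
  have hφ0 : ∀ t ∈ Icc (0 : ℝ) 1, ∀ x ∈ closure V, x ∉ K → φ (h (t, x)) = 0 := by
    intro t ht x hx hxK
    refine hφr _ ?_
    by_contra hle
    exact hxK ⟨(t, x), ⟨⟨ht, hx⟩, not_lt.1 hle⟩, rfl⟩
  have h0 : ∀ t ∈ Icc (0 : ℝ) 1, ∀ x, fderiv ℝ ψ x = 0 ∨ φ (h (t, x)) = 0 := by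
    intro t ht x
    by_cases hxK : x ∈ K
    · left
      have : ψ =ᶠ[𝓝 x] fun _ => (1 : ℝ) := hψ1.filter_mono (nhds_le_nhdsSet hxK)
      rw [this.fderiv_eq]; simp
    by_cases hxV : x ∈ closure V
    · exact Or.inr (hφ0 t ht x hxV hxK)
    · left
      have : x ∉ tsupport ψ := fun h => hxV (subset_closure (hLV (hsub h)))
      exact image_eq_zero_of_notMem_tsupport (fun h => this (tsupport_fderiv_subset ℝ (f := ψ) h))
  have key : ∀ t ∈ Icc (0 : ℝ) 1, ∀ g : E → E, (∀ x, g x = h (t, x)) →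
      ∫ x in V, φ (g x) * (fderiv ℝ g x).det ∂μ =
        ∫ x, ψ x * (φ (g x) * (fderiv ℝ g x).det) ∂μ := by
    intro t ht g hg
    rw [← setIntegral_eq_integral_of_forall_compl_eq_zero (s := V)
      (f := fun x => ψ x * (φ (g x) * (fderiv ℝ g x).det))]
    · refine setIntegral_congr_fun hV.measurableSet fun x hx => ?_
      by_cases hxK : x ∈ K
      · simp [hψ1.self_of_nhdsSet x hxK]
      · simp [hg, hφ0 t ht x (subset_closure hx) hxK]
    · intro x hx
      rw [hψ0 x fun h => hx (hLV h), zero_mul]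
  have main := integral_density_eq μ (Module.finBasis ℝ E) hg₀ (hg₁.sub hg₀) hφ hψ hc h0
  rw [key 0 (by simp) g₀ (by simp [hh]), key 1 (by simp) g₁ (by simp [hh]), main]
  simp

end Homotopy

/-! ### From the integral to the sum of indices at a regular value. -/

section RegularValues

open MeasureTheory

variable {k : ℕ}

theorem hasStrictFDerivAt_of_det_ne_zero {G : Euc k → Euc k} (hG : ContDiff ℝ ∞ G) {x : Euc k}
    (hx : (fderiv ℝ G x).det ≠ 0) :
    ∃ e : Euc k ≃L[ℝ] Euc k, HasStrictFDerivAt G (e : Euc k →L[ℝ] Euc k) x := by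
  refine ⟨(fderiv ℝ G x).toContinuousLinearEquivOfDetNeZero hx, ?_⟩
  exact hG.contDiffAt.hasStrictFDerivAt (by simp)

/-- The inverse function theorem, together with the continuity of the Jacobian. -/
theorem exists_nhd_of_det_ne_zero {G : Euc k → Euc k} (hG : ContDiff ℝ ∞ G) {V : Set (Euc k)}
    (hV : IsOpen V) {x : Euc k} (hxV : x ∈ V) (hx : (fderiv ℝ G x).det ≠ 0) :
    ∃ N, IsOpen N ∧ x ∈ N ∧ N ⊆ V ∧ InjOn G N ∧
      ∀ z ∈ N, SignType.sign (fderiv ℝ G z).det = SignType.sign (fderiv ℝ G x).det := by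
  obtain ⟨e, he⟩ := hasStrictFDerivAt_of_det_ne_zero hG hx
  have hdet : Continuous fun z => (fderiv ℝ G z).det :=
    ContinuousLinearMap.continuous_det.comp (hG.continuous_fderiv (by simp))
  have hs : {z | SignType.sign (fderiv ℝ G z).det = SignType.sign (fderiv ℝ G x).det} ∈ 𝓝 x := by
    rcases lt_or_gt_of_ne hx with h | h
    · filter_upwards [hdet.continuousAt.eventually_lt_const h] with z hz
      rw [sign_neg hz, sign_neg h]
    · filter_upwards [hdet.continuousAt.eventually_const_lt h] with z hz
      rw [sign_pos hz, sign_pos h]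
  obtain ⟨N, hN, hNo, hxN⟩ := mem_nhds_iff.1 (Filter.inter_mem hs (hV.mem_nhds hxV))
  refine ⟨N ∩ (he.toOpenPartialHomeomorph G).source, hNo.inter
    (he.toOpenPartialHomeomorph G).open_source, ⟨hxN, he.mem_toOpenPartialHomeomorph_source⟩,
    fun z hz => (hN hz.1).2, ?_, fun z hz => (hN hz.1).1⟩
  exact (he.toOpenPartialHomeomorph G).injOn.mono inter_subset_right

theorem map_nhds_of_det_ne_zero {G : Euc k → Euc k} (hG : ContDiff ℝ ∞ G) {x : Euc k}
    (hx : (fderiv ℝ G x).det ≠ 0) : Filter.map G (𝓝 x) = 𝓝 (G x) := by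
  obtain ⟨e, he⟩ := hasStrictFDerivAt_of_det_ne_zero hG hx
  exact he.map_nhds_eq_of_equiv

/-- The zero set is compact because the frontier carries no zeros, and local injectivity makes it
discrete. -/
theorem finite_zeros {G : Euc k → Euc k} (hG : ContDiff ℝ ∞ G) {V : Set (Euc k)}
    (hV : IsOpen V) (hVb : Bornology.IsBounded V) (hfr : ∀ x ∈ frontier V, G x ≠ 0)
    (hreg : ∀ x ∈ V, G x = 0 → (fderiv ℝ G x).det ≠ 0) : (V ∩ G ⁻¹' {0}).Finite := by
  have hS : V ∩ G ⁻¹' {0} = closure V ∩ G ⁻¹' {0} := by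
    refine Subset.antisymm (inter_subset_inter_left _ subset_closure) fun x hx => ⟨?_, hx.2⟩
    by_contra hxV
    exact hfr x (by rw [hV.frontier_eq]; exact ⟨hx.1, hxV⟩) hx.2
  have hc : IsCompact (V ∩ G ⁻¹' {0}) := by
    rw [hS]
    exact hVb.isCompact_closure.inter_right (isClosed_singleton.preimage hG.continuous)
  have hN : ∀ x ∈ V ∩ G ⁻¹' {0}, ∃ N ∈ 𝓝 x, InjOn G N := by
    intro x hx
    obtain ⟨N, hNo, hxN, -, hinj, -⟩ := exists_nhd_of_det_ne_zero hG hV hx.1 (hreg x hx.1 hx.2)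
    exact ⟨N, hNo.mem_nhds hxN, hinj⟩
  choose! N hN hinj using hN
  obtain ⟨t, ht, hcov⟩ := hc.elim_nhds_subcover N hN
  refine t.finite_toSet.subset fun x hx => ?_
  obtain ⟨y, hy, hxy⟩ := mem_iUnion₂.1 (hcov hx)
  have h1 := ht y hy
  have : x = y := hinj y h1 hxy (mem_of_mem_nhds (hN y h1)) (hx.2.trans h1.2.symm)
  rwa [this]

/-- Near a regular value, the degree integral computes the sum of the indices. -/
theorem exists_setIntegral_eq {G : Euc k → Euc k} (hG : ContDiff ℝ ∞ G) {V : Set (Euc k)}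
    (hV : IsOpen V) (hVb : Bornology.IsBounded V) (hfr : ∀ x ∈ frontier V, G x ≠ 0)
    (hreg : ∀ x ∈ V, G x = 0 → (fderiv ℝ G x).det ≠ 0) :
    ∃ r > 0, ∀ φ : Euc k → ℝ, Continuous φ → (∀ y, r ≤ ‖y‖ → φ y = 0) →
      ∫ x in V, φ (G x) * (fderiv ℝ G x).det =
        ((regularDegree G V 0 : ℤ) : ℝ) * ∫ y, φ y := by
  have hfin := finite_zeros hG hV hVb hfr hreg
  have hVc : IsCompact (closure V) := hVb.isCompact_closure
  have hN : ∀ x ∈ V ∩ G ⁻¹' {0}, ∃ N, IsOpen N ∧ x ∈ N ∧ N ⊆ V ∧ InjOn G N ∧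
      ∀ z ∈ N, SignType.sign (fderiv ℝ G z).det = SignType.sign (fderiv ℝ G x).det :=
    fun x hx => exists_nhd_of_det_ne_zero hG hV hx.1 (hreg x hx.1 hx.2)
  choose! N' hN'o hN'x hN'V hN'i hN's using hN
  obtain ⟨O, hO, hdisj⟩ := hfin.t2_separation
  set N : Euc k → Set (Euc k) := fun x => N' x ∩ O x with hNdef
  set S : Finset (Euc k) := hfin.toFinset with hSdef
  have hS : ∀ x, x ∈ S ↔ x ∈ V ∩ G ⁻¹' {0} := fun x => hfin.mem_toFinset
  have hNo : ∀ x ∈ S, IsOpen (N x) := fun x hx => (hN'o x ((hS x).1 hx)).inter (hO x).2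
  have hNx : ∀ x ∈ S, x ∈ N x := fun x hx => ⟨hN'x x ((hS x).1 hx), (hO x).1⟩
  have hNV : ∀ x ∈ S, N x ⊆ V := fun x hx => inter_subset_left.trans (hN'V x ((hS x).1 hx))
  -- Away from the chosen neighbourhoods `G` is bounded away from 0 by compactness. The radius `r`
  -- is such that the ball misses `G '' C` and lies in each `G '' N x`.
  set C : Set (Euc k) := closure V \ ⋃ x ∈ S, N x with hC
  have hCc : IsCompact C := hVc.diff (isOpen_biUnion hNo)
  have h0C : (0 : Euc k) ∉ G '' C := by
    rintro ⟨x, hx, hx0⟩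
    by_cases hxV : x ∈ V
    · have hxS : x ∈ S := (hS x).2 ⟨hxV, hx0⟩
      exact hx.2 (mem_iUnion₂.2 ⟨x, hxS, hNx x hxS⟩)
    · exact hfr x (by rw [hV.frontier_eq]; exact ⟨hx.1, hxV⟩) hx0
  have hnhds : (G '' C)ᶜ ∩ ⋂ x ∈ S, G '' N x ∈ 𝓝 (0 : Euc k) := by
    refine Filter.inter_mem ((hCc.image hG.continuous).isClosed.isOpen_compl.mem_nhds h0C) ?_
    rw [Filter.biInter_finset_mem]
    intro x hx
    have hx' := (hS x).1 hx
    have h := map_nhds_of_det_ne_zero hG (hreg x hx'.1 hx'.2)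
    rw [show G x = 0 from hx'.2] at h
    rw [← h]
    exact Filter.image_mem_map ((hNo x hx).mem_nhds (hNx x hx))
  obtain ⟨r, hr, hball⟩ := Metric.mem_nhds_iff.1 hnhds
  refine ⟨r, hr, fun φ hφ hφr => ?_⟩
  have hφb : ∀ y, y ∉ Metric.ball (0 : Euc k) r → φ y = 0 := fun y hy =>
    hφr y (by simpa using hy)
  have hcont : Continuous fun x => φ (G x) * (fderiv ℝ G x).det :=
    (hφ.comp hG.continuous).mul
      (ContinuousLinearMap.continuous_det.comp (hG.continuous_fderiv (by simp)))
  have hint : IntegrableOn (fun x => φ (G x) * (fderiv ℝ G x).det) (closure V) :=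
    hcont.continuousOn.integrableOn_compact hVc
  have hsub : (⋃ x ∈ S, N x) ⊆ V := iUnion₂_subset hNV
  rw [setIntegral_eq_of_subset_of_forall_sdiff_eq_zero hV.measurableSet hsub]
  swap
  · intro x hx
    rw [hφb, zero_mul]
    intro hb
    exact (hball hb).1 ⟨x, ⟨subset_closure hx.1, hx.2⟩, rfl⟩
  rw [integral_biUnion_finset S (fun x hx => (hNo x hx).measurableSet)]
  rotate_left
  · intro x hx y hy hxy
    exact (hdisj ((hS x).1 hx) ((hS y).1 hy) hxy).mono inter_subset_right inter_subset_right
  · exact fun x hx => hint.mono_set ((hNV x hx).trans subset_closure)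
  have hdeg : regularDegree G V 0 = ∑ x ∈ S, index G x :=
    finsum_mem_eq_finite_toFinset_sum _ hfin
  rw [hdeg, Int.cast_sum, Finset.sum_mul]
  refine Finset.sum_congr rfl fun x hx => ?_
  have hinj : InjOn G (N x) := (hN'i x ((hS x).1 hx)).mono inter_subset_left
  -- Since `G '' N x` contains the support of `φ`, each neighbourhood contributes the full integral
  -- of `φ`, with the constant sign of the Jacobian there.
  have hcv := integral_image_eq_integral_abs_det_fderiv_smul volume (hNo x hx).measurableSet
    (fun z _ => ((hG.differentiable (by simp)) z).hasFDerivAt.hasFDerivWithinAt) hinj φ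
  rw [setIntegral_eq_integral_of_forall_compl_eq_zero] at hcv
  swap
  · intro y hy
    refine hφb y fun hb => hy ?_
    exact mem_iInter₂.1 (hball hb).2 x hx
  rw [hcv, ← integral_const_mul]
  refine setIntegral_congr_fun (hNo x hx).measurableSet fun z hz => ?_
  have hs := hN's x ((hS x).1 hx) z hz.1
  simp only [index, ← hs, smul_eq_mul]
  have h1 := sign_mul_abs (fderiv ℝ G z).det
  conv_lhs => rw [← h1]
  have h2 : ∀ s : SignType, ((s : ℤ) : ℝ) = (s : ℝ) := by intro s; cases s <;> simp
  rw [h2]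
  ring

theorem exists_bump (k : ℕ) {r : ℝ} (hr : 0 < r) : ∃ φ : Euc k → ℝ, ContDiff ℝ ∞ φ ∧
    (∀ y, r ≤ ‖y‖ → φ y = 0) ∧ ∫ y, φ y = 1 := by
  let f : ContDiffBump (0 : Euc k) := ⟨r / 2, r, by positivity, by linarith⟩
  refine ⟨f.normed volume, f.contDiff_normed, fun y hy => ?_, f.integral_normed⟩
  have : y ∉ Function.support (f.normed volume) := by
    rw [f.support_normed_eq]; simpa using hy
  simpa using this

theorem regularDegree_zero_eq {G₀ G₁ : Euc k → Euc k} (hG₀ : ContDiff ℝ ∞ G₀)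
    (hG₁ : ContDiff ℝ ∞ G₁) {V : Set (Euc k)} (hV : IsOpen V) (hVb : Bornology.IsBounded V)
    (hne : ∀ t ∈ Icc (0 : ℝ) 1, ∀ x ∈ frontier V, G₀ x + t • (G₁ x - G₀ x) ≠ 0)
    (hreg₀ : ∀ x ∈ V, G₀ x = 0 → (fderiv ℝ G₀ x).det ≠ 0)
    (hreg₁ : ∀ x ∈ V, G₁ x = 0 → (fderiv ℝ G₁ x).det ≠ 0) :
    regularDegree G₀ V 0 = regularDegree G₁ V 0 := by
  obtain ⟨r₀, hr₀, h₀⟩ := exists_setIntegral_eq hG₀ hV hVb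
    (fun x hx => by simpa using hne 0 (by simp) x hx) hreg₀
  obtain ⟨r₁, hr₁, h₁⟩ := exists_setIntegral_eq hG₁ hV hVb
    (fun x hx => by simpa using hne 1 (by simp) x hx) hreg₁
  have hfc : IsCompact (frontier V) := hVb.isCompact_closure.of_isClosed_subset isClosed_frontier
    frontier_subset_closure
  set h : ℝ × Euc k → Euc k := fun p => G₀ p.2 + p.1 • (G₁ p.2 - G₀ p.2)
  have hhc : Continuous h := by
    have := hG₀.continuous
    have := hG₁.continuous
    fun_prop
  have hclosed := ((isCompact_Icc (a := (0 : ℝ)) (b := 1)).prod hfc).image hhc |>.isClosed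
  have hn : (h '' (Icc (0 : ℝ) 1 ×ˢ frontier V))ᶜ ∈ 𝓝 (0 : Euc k) := by
    refine hclosed.isOpen_compl.mem_nhds ?_
    rintro ⟨⟨t, x⟩, ⟨ht, hx⟩, h0⟩
    exact hne t ht x hx h0
  obtain ⟨r₂, hr₂, hball⟩ := Metric.nhds_basis_closedBall.mem_iff.1 hn
  -- One bump must compute both degrees (`r₀`, `r₁`) and avoid the image of the frontier throughout
  -- the homotopy (`r₂`).
  obtain ⟨φ, hφ, hφr, hφ1⟩ := exists_bump k (lt_min (lt_min hr₀ hr₁) hr₂)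
  have e₀ := h₀ φ hφ.continuous fun y hy => hφr y
    (((min_le_left _ _).trans (min_le_left _ _)).trans hy)
  have e₁ := h₁ φ hφ.continuous fun y hy => hφr y
    (((min_le_left _ _).trans (min_le_right _ _)).trans hy)
  have e := setIntegral_density_eq volume hG₀ hG₁ hV hVb (r := r₂) (fun t ht x hx => by
    by_contra hle
    exact hball (by simpa [h] using hle) ⟨(t, x), ⟨ht, hx⟩, rfl⟩) hφ
    (fun y hy => hφr y ((min_le_right _ _).trans hy.le))
  rw [e₀, e₁, hφ1, mul_one, mul_one] at e
  exact_mod_cast e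

/-- Multiplying the local extension by a cutoff makes it global, as the integral arguments require.
-/
theorem SmoothOn.exists_contDiff {g : Euc k → Euc k} {X : Set (Euc k)} (hg : SmoothOn g X)
    (hX : IsCompact X) : ∃ G : Euc k → Euc k, ContDiff ℝ ∞ G ∧ EqOn g G X := by
  obtain ⟨W, F, hW, hXW, hF, hgF⟩ := hg
  obtain ⟨L, hL, hXL, hLW⟩ := exists_compact_between hX hW hXW
  obtain ⟨ψ, hψ1, hψ0, -⟩ := exists_contMDiffMap_one_nhds_of_subset_interior
    (n := ⊤) (modelWithCornersSelf ℝ (Euc k)) hX.isClosed hXL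
  have hψ : ContDiff ℝ ∞ ψ := ψ.contMDiff.contDiff
  have hsub : tsupport ψ ⊆ L := by
    refine closure_minimal (fun x hx => ?_) hL.isClosed
    by_contra h; exact hx (hψ0 x h)
  refine ⟨fun x => ψ x • F x, ?_, fun x hx => ?_⟩
  · rw [contDiff_iff_contDiffAt]
    intro x
    by_cases hx : x ∈ W
    · exact hψ.contDiffAt.smul (hF.contDiffAt (hW.mem_nhds hx))
    · have hx' : x ∉ tsupport ψ := fun h => hx (hLW (hsub h))
      refine (contDiffAt_const (c := (0 : Euc k))).congr_of_eventuallyEq ?_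
      filter_upwards [notMem_tsupport_iff_eventuallyEq.1 hx'] with z hz
      simp [hz]
  · simp [hψ1.self_of_nhdsSet x hx, hgF hx]

theorem det_ne_zero_iff_surjective (L : Euc k →L[ℝ] Euc k) :
    L.det ≠ 0 ↔ Function.Surjective L := by
  have h : L.det = LinearMap.det (L : Euc k →ₗ[ℝ] Euc k) := rfl
  rw [h, ← isUnit_iff_ne_zero, ← LinearMap.isUnit_iff_isUnit_det,
    LinearMap.isUnit_iff_range_eq_top, LinearMap.range_eq_top]
  rfl

/-- A regular triple on a bounded set can be replaced by a globally smooth map with target `0`. -/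
theorem RegularTriple.exists_global {g : Euc k → Euc k} {V : Set (Euc k)} {z : Euc k}
    (h : RegularTriple g V z) (hVb : Bornology.IsBounded V) :
    ∃ G : Euc k → Euc k, ContDiff ℝ ∞ G ∧ (∀ x ∈ closure V, G x = g x - z) ∧
      (∀ x ∈ V, G x = 0 → (fderiv ℝ G x).det ≠ 0) ∧ V ∩ g ⁻¹' {z} = V ∩ G ⁻¹' {0} ∧
      regularDegree g V z = regularDegree G V 0 := by
  obtain ⟨F, hF, hgF⟩ := h.smooth.exists_contDiff hVb.isCompact_closure
  have hder : ∀ x ∈ V, fderiv ℝ (fun x => F x - z) x = fderiv ℝ g x := by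
    intro x hx
    have : g =ᶠ[𝓝 x] F := by
      filter_upwards [h.admissible.isOpen.mem_nhds hx] with y hy using hgF (subset_closure hy)
    rw [fderiv_sub_const, this.fderiv_eq]
  have hset : V ∩ g ⁻¹' {z} = V ∩ (fun x => F x - z) ⁻¹' {0} := by
    ext x
    simp only [mem_inter_iff, mem_preimage, mem_singleton_iff, sub_eq_zero]
    exact and_congr_right fun hx => by rw [hgF (subset_closure hx)]
  refine ⟨fun x => F x - z, hF.sub contDiff_const, fun x hx => by rw [hgF hx], ?_, hset, ?_⟩
  · intro x hx hx0
    rw [hder x hx, det_ne_zero_iff_surjective]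
    exact h.regular x hx (by rw [hgF (subset_closure hx)]; exact sub_eq_zero.1 hx0)
  · rw [regularDegree, regularDegree, hset]
    exact finsum_mem_congr rfl fun x hx => by rw [index, index, hder x hx.1]

theorem RegularTriple.finite {g : Euc k → Euc k} {V : Set (Euc k)} {z : Euc k}
    (h : RegularTriple g V z) (hVb : Bornology.IsBounded V) : (V ∩ g ⁻¹' {z}).Finite := by
  obtain ⟨G, hG, hGg, hreg, hset, -⟩ := h.exists_global hVb
  rw [hset]
  refine finite_zeros hG h.admissible.isOpen hVb (fun x hx => ?_) hreg
  rw [hGg x (frontier_subset_closure hx), sub_ne_zero]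
  exact h.admissible.ne_of_mem_frontier x hx

theorem RegularTriple.regularDegree_eq {g₀ g₁ : Euc k → Euc k} {V : Set (Euc k)} {z₀ z₁ : Euc k}
    (h₀ : RegularTriple g₀ V z₀) (h₁ : RegularTriple g₁ V z₁) (hVb : Bornology.IsBounded V)
    (hne : ∀ t ∈ Icc (0 : ℝ) 1, ∀ x ∈ frontier V,
      (g₀ x - z₀) + t • ((g₁ x - z₁) - (g₀ x - z₀)) ≠ 0) :
    regularDegree g₀ V z₀ = regularDegree g₁ V z₁ := by
  obtain ⟨G₀, hG₀, hG₀g, hreg₀, -, hd₀⟩ := h₀.exists_global hVb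
  obtain ⟨G₁, hG₁, hG₁g, hreg₁, -, hd₁⟩ := h₁.exists_global hVb
  rw [hd₀, hd₁]
  refine regularDegree_zero_eq hG₀ hG₁ h₀.admissible.isOpen hVb (fun t ht x hx => ?_) hreg₀ hreg₁
  rw [hG₀g x (frontier_subset_closure hx), hG₁g x (frontier_subset_closure hx)]
  exact hne t ht x hx

end RegularValues

/-! ### Admissible triples on bounded sets: approximation and additivity. -/

section Degree

open MeasureTheory

variable {k : ℕ}

/-- The real bound `c` replaces the distance, which is infinite when `F` is empty. -/
theorem ofReal_lt_infEDist_iff {F : Set (Euc k)} {f : Euc k → Euc k} {y : Euc k} {a : ℝ}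
    (ha : 0 ≤ a) : ENNReal.ofReal a < Metric.infEDist y (f '' F) ↔
      ∃ c > a, ∀ x ∈ F, c ≤ ‖f x - y‖ := by
  constructor
  · intro h
    obtain ⟨c, hc1, hc2⟩ := ENNReal.lt_iff_exists_nnreal_btwn.1 h
    refine ⟨c, ?_, fun x hx => ?_⟩
    · rw [← ENNReal.ofReal_coe_nnreal] at hc1
      exact (ENNReal.ofReal_lt_ofReal_iff_of_nonneg ha).1 hc1
    · have h1 := hc2.le.trans (Metric.infEDist_le_edist_of_mem (mem_image_of_mem f hx))
      rw [edist_comm, edist_dist, dist_eq_norm, ← ENNReal.ofReal_coe_nnreal] at h1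
      exact (ENNReal.ofReal_le_ofReal_iff (norm_nonneg _)).1 h1
  · rintro ⟨c, hc, h⟩
    refine lt_of_lt_of_le ((ENNReal.ofReal_lt_ofReal_iff_of_nonneg ha).2 hc) ?_
    rw [Metric.le_infEDist]
    rintro _ ⟨x, hx, rfl⟩
    rw [edist_comm, edist_dist, dist_eq_norm]
    exact ENNReal.ofReal_le_ofReal (h x hx)

theorem Approximates.regularDegree_eq {f g₀ g₁ : Euc k → Euc k} {V : Set (Euc k)}
    {y z₀ z₁ : Euc k} (h₀ : Approximates g₀ z₀ f V y) (h₁ : Approximates g₁ z₁ f V y)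
    (hVb : Bornology.IsBounded V) : regularDegree g₀ V z₀ = regularDegree g₁ V z₁ := by
  obtain ⟨hr₀, ε₀, σ₀, hε₀, hσ₀, hf₀, hz₀, hd₀⟩ := h₀
  obtain ⟨hr₁, ε₁, σ₁, hε₁, hσ₁, hf₁, hz₁, hd₁⟩ := h₁
  obtain ⟨c₀, hc₀, hF₀⟩ := (ofReal_lt_infEDist_iff (by positivity)).1 hd₀
  obtain ⟨c₁, hc₁, hF₁⟩ := (ofReal_lt_infEDist_iff (by positivity)).1 hd₁
  refine hr₀.regularDegree_eq hr₁ hVb fun t ht x hx h0 => ?_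
  have hxc := frontier_subset_closure hx
  -- At a zero of the homotopy, `f x - y` would be a convex combination of two vectors strictly
  -- shorter than itself.
  have e : f x - y = (1 - t) • ((f x - g₀ x) + (z₀ - y)) + t • ((f x - g₁ x) + (z₁ - y)) +
      ((g₀ x - z₀) + t • ((g₁ x - z₁) - (g₀ x - z₀))) := by module
  rw [h0, add_zero] at e
  have n₀ : ‖(f x - g₀ x) + (z₀ - y)‖ < ‖f x - y‖ :=
    (norm_add_le _ _).trans_lt (by linarith [hf₀ x hxc, hF₀ x hx])
  have n₁ : ‖(f x - g₁ x) + (z₁ - y)‖ < ‖f x - y‖ :=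
    (norm_add_le _ _).trans_lt (by linarith [hf₁ x hxc, hF₁ x hx])
  have hb := convex_ball (0 : Euc k) ‖f x - y‖ (mem_ball_zero_iff.2 n₀) (mem_ball_zero_iff.2 n₁)
    (sub_nonneg.2 ht.2) ht.1 (by ring)
  rw [← e, mem_ball_zero_iff] at hb
  exact lt_irrefl _ hb

theorem Approximates.admissibleDegree_eq {f g : Euc k → Euc k} {V : Set (Euc k)}
    {y z : Euc k} (h : Approximates g z f V y) (hVb : Bornology.IsBounded V) :
    admissibleDegree f V y = regularDegree g V z := by
  obtain ⟨g', z', h', hd⟩ := Classical.epsilon_spec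
    (p := fun d : ℤ => ∃ g z, Approximates g z f V y ∧ d = regularDegree g V z) ⟨_, g, z, h, rfl⟩
  exact hd.trans (h'.regularDegree_eq h hVb)

/-- Smooth approximation by a map having a given nearby point as a regular value. -/
theorem exists_smooth_regular_approx {f : Euc k → Euc k} {X : Set (Euc k)} (hX : IsCompact X)
    (hf : ContinuousOn f X) (y : Euc k) {ε : ℝ} (hε : 0 < ε) :
    ∃ (g : Euc k → Euc k) (z : Euc k), ContDiff ℝ ∞ g ∧ (∀ x ∈ X, ‖f x - g x‖ ≤ ε) ∧
      ‖z - y‖ ≤ ε ∧ ∀ x, g x = z → Function.Surjective (fderiv ℝ g x) := by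
  have : TietzeExtension.{0} (Euc k) := TietzeExtension.of_tvs ℝ
  obtain ⟨F, hF⟩ := ContinuousMap.exists_restrict_eq hX.isClosed
    (⟨X.domRestrict f, continuousOn_iff_continuous_domRestrict.1 hf⟩ : C(X, Euc k))
  have hFf : ∀ x ∈ X, F x = f x := fun x hx => congrArg (fun φ : C(X, Euc k) => φ ⟨x, hx⟩) hF
  obtain ⟨g, hg, hgF, -⟩ := F.continuous.exists_contDiff_approx ⊤ (ε := fun _ => ε)
    continuous_const (fun _ => hε)
  -- Sard's theorem in equal dimensions: the critical values form a null set, so every ball contains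
  -- a regular value.
  have hnull := addHaar_image_eq_zero_of_det_fderivWithin_eq_zero (volume : Measure (Euc k))
    (s := {x | (fderiv ℝ g x).det = 0}) (f := g) (f' := fderiv ℝ g)
    (fun x _ => ((hg.differentiable (by simp)) x).hasFDerivAt.hasFDerivWithinAt) (fun x hx => hx)
  obtain ⟨z, hz, hzg⟩ : ∃ z ∈ Metric.ball y ε, z ∉ g '' {x | (fderiv ℝ g x).det = 0} := by
    by_contra! hcon
    exact (Metric.measure_ball_pos volume y hε).ne' (measure_mono_null hcon hnull)
  refine ⟨g, z, hg, fun x hx => ?_, ?_, fun x hx => ?_⟩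
  · rw [← hFf x hx, ← dist_eq_norm, dist_comm]
    exact (hgF x).le
  · rw [← dist_eq_norm]; exact hz.le
  · rw [← det_ne_zero_iff_surjective]
    exact fun h => hzg ⟨x, h, hx⟩

/-- A common approximation on all open subsets of `V` whose boundary avoids the solutions. -/
theorem exists_common_approximation {f : Euc k → Euc k} {V C : Set (Euc k)} {y : Euc k}
    (hVb : Bornology.IsBounded V) (hf : ContinuousOn f (closure V))
    (hC : IsClosed C) (hCV : C ⊆ closure V) (hy : ∀ x ∈ C, f x ≠ y) :
    ∃ g z, (∀ x ∈ C, g x ≠ z) ∧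
      ∀ W, IsOpen W → W ⊆ V → frontier W ⊆ C → Approximates g z f W y := by
  have hVc := hVb.isCompact_closure
  have hCc : IsCompact C := hVc.of_isClosed_subset hC hCV
  have hcl : IsClosed (f '' C) := (hCc.image_of_continuousOn (hf.mono hCV)).isClosed
  have hpos : ENNReal.ofReal 0 < Metric.infEDist y (f '' C) := by
    rw [ENNReal.ofReal_zero, Metric.infEDist_pos_iff_notMem_closure, hcl.closure_eq]
    rintro ⟨x, hx, h⟩
    exact hy x hx h
  obtain ⟨c, hc, hCc'⟩ := (ofReal_lt_infEDist_iff le_rfl).1 hpos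
  -- With `c / 3` for both errors, their sum stays below the distance bound `c`.
  obtain ⟨g, z, hg, hgf, hz, hreg⟩ := exists_smooth_regular_approx hVc hf y
    (ε := c / 3) (by positivity)
  have hne : ∀ x ∈ C, g x ≠ z := by
    intro x hx h
    have h1 := hgf x (hCV hx)
    have h2 := hCc' x hx
    have h3 := norm_add_le (f x - g x) (z - y)
    rw [h, sub_add_sub_cancel] at h3
    rw [h] at h1
    linarith
  refine ⟨g, z, hne, fun W hW hWV hWC => ⟨⟨⟨hW, hg.continuous.continuousOn, fun K hK => ?_,
    fun x hx => hne x (hWC hx)⟩, ?_, fun x _ hx => hreg x hx⟩, c / 3, c / 3, by positivity,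
    by positivity, fun x hx => hgf x (closure_mono hWV hx), hz, ?_⟩⟩
  · exact (hVb.subset hWV).isCompact_closure.inter_right (hK.isClosed.preimage hg.continuous)
  · exact ⟨univ, g, isOpen_univ, subset_univ _, hg.contDiffOn, fun _ _ => rfl⟩
  · exact (ofReal_lt_infEDist_iff (by positivity)).2
      ⟨c, by linarith [show (0:ℝ) < c from hc], fun x hx => hCc' x (hWC hx)⟩

theorem Admissible.exists_approximates {f : Euc k → Euc k} {V : Set (Euc k)} {y : Euc k}
    (h : Admissible f V y) (hVb : Bornology.IsBounded V) : ∃ g z, Approximates g z f V y := by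
  obtain ⟨g, z, -, hg⟩ := exists_common_approximation hVb h.continuousOn isClosed_frontier
    frontier_subset_closure h.ne_of_mem_frontier
  exact ⟨g, z, hg V h.isOpen Subset.rfl Subset.rfl⟩

theorem admissibleDegree_add {f : Euc k → Euc k} {V V₁ V₂ : Set (Euc k)} {y : Euc k}
    (hV : IsOpen V) (hVb : Bornology.IsBounded V) (hf : ContinuousOn f (closure V))
    (hV₁ : IsOpen V₁) (hV₂ : IsOpen V₂) (h₁ : V₁ ⊆ V) (h₂ : V₂ ⊆ V) (hd : Disjoint V₁ V₂)
    (hy : ∀ x ∈ closure V, x ∉ V₁ ∪ V₂ → f x ≠ y) :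
    admissibleDegree f V y = admissibleDegree f V₁ y + admissibleDegree f V₂ y := by
  -- The frontiers of `V`, `V₁` and `V₂` all lie in this closed set, so one regular triple
  -- approximates on all three, and its solutions in `V` split between `V₁` and `V₂`.
  obtain ⟨g, z, hne, hg⟩ := exists_common_approximation hVb hf (C := closure V \ (V₁ ∪ V₂))
    (isClosed_closure.sdiff (hV₁.union hV₂)) sdiff_subset (fun x hx => hy x hx.1 hx.2)
  have a := hg V hV Subset.rfl fun x hx => by
    rw [hV.frontier_eq] at hx
    exact ⟨hx.1, fun h => hx.2 (union_subset h₁ h₂ h)⟩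
  have a₁ := hg V₁ hV₁ h₁ fun x hx => by
    rw [hV₁.frontier_eq] at hx
    exact ⟨closure_mono h₁ hx.1, fun h => h.elim hx.2
      fun h => (hd.closure_left hV₂).le_bot ⟨hx.1, h⟩⟩
  have a₂ := hg V₂ hV₂ h₂ fun x hx => by
    rw [hV₂.frontier_eq] at hx
    exact ⟨closure_mono h₂ hx.1, fun h => h.elim
      (fun h => (hd.closure_right hV₁).le_bot ⟨h, hx.1⟩) hx.2⟩
  rw [a.admissibleDegree_eq hVb, a₁.admissibleDegree_eq (hVb.subset h₁),
    a₂.admissibleDegree_eq (hVb.subset h₂), regularDegree, regularDegree, regularDegree,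
    ← finsum_mem_union (hd.mono inter_subset_left inter_subset_left)
      (a₁.1.finite (hVb.subset h₁)) (a₂.1.finite (hVb.subset h₂)), ← union_inter_distrib_right]
  have hset : V ∩ g ⁻¹' {z} = (V₁ ∪ V₂) ∩ g ⁻¹' {z} := by
    ext x
    refine ⟨fun hx => ⟨?_, hx.2⟩, fun hx => ⟨union_subset h₁ h₂ hx.1, hx.2⟩⟩
    by_contra h
    exact hne x ⟨subset_closure hx.1, h⟩ hx.2
  rw [hset]

/-- Additivity for the empty set reads `d = d + d`. -/
theorem admissibleDegree_empty (f : Euc k → Euc k) (y : Euc k) : admissibleDegree f ∅ y = 0 := by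
  have := admissibleDegree_add (f := f) (V := ∅) (V₁ := ∅) (V₂ := ∅) (y := y) isOpen_empty
    Bornology.isBounded_empty (by simp) isOpen_empty isOpen_empty Subset.rfl Subset.rfl
    (disjoint_empty _) (by simp)
  linarith

theorem admissibleDegree_excision {f : Euc k → Euc k} {V W : Set (Euc k)} {y : Euc k}
    (hV : IsOpen V) (hVb : Bornology.IsBounded V) (hf : ContinuousOn f (closure V))
    (hW : IsOpen W) (hWV : W ⊆ V) (hy : ∀ x ∈ closure V, x ∉ W → f x ≠ y) :
    admissibleDegree f V y = admissibleDegree f W y := by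
  rw [admissibleDegree_add hV hVb hf hW isOpen_empty hWV (empty_subset _) (disjoint_empty _)
    (by simpa using hy), admissibleDegree_empty, add_zero]

/-! ### Weakly admissible triples: independence of the neighbourhood, and additivity. -/

theorem IsolatingNhd.ne {f : Euc k → Euc k} {U V : Set (Euc k)} {y : Euc k}
    (hV : IsolatingNhd f U y V) {x : Euc k} (hx : x ∈ U) (hxV : x ∉ V) : f x ≠ y :=
  fun h => hxV (hV.subset ⟨hx, h⟩)

theorem IsolatingNhd.admissible {f : Euc k → Euc k} {U V : Set (Euc k)} {y : Euc k}
    (hV : IsolatingNhd f U y V) (hf : ContinuousOn f U) : Admissible f V y := by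
  have hfV := hf.mono hV.closure_subset
  refine ⟨hV.isOpen, hfV, fun K hK => ?_, fun x hx => ?_⟩
  · exact hV.isBounded.isCompact_closure.of_isClosed_subset
      (hfV.preimage_isClosed_of_isClosed isClosed_closure hK.isClosed) inter_subset_left
  · rw [hV.isOpen.frontier_eq] at hx
    exact hV.ne (hV.closure_subset hx.1) hx.2

theorem IsolatingNhd.inter {f : Euc k → Euc k} {U V W : Set (Euc k)} {y : Euc k}
    (hV : IsolatingNhd f U y V) (hW : IsolatingNhd f U y W) : IsolatingNhd f U y (V ∩ W) :=
  ⟨hV.isOpen.inter hW.isOpen, hV.isBounded.subset inter_subset_left,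
    subset_inter hV.subset hW.subset, (closure_mono inter_subset_left).trans hV.closure_subset⟩

theorem IsolatingNhd.admissibleDegree_eq_of_subset {f : Euc k → Euc k} {U V W : Set (Euc k)}
    {y : Euc k} (hV : IsolatingNhd f U y V) (hW : IsolatingNhd f U y W)
    (hf : ContinuousOn f U) (hWV : W ⊆ V) : admissibleDegree f V y = admissibleDegree f W y :=
  admissibleDegree_excision hV.isOpen hV.isBounded (hf.mono hV.closure_subset) hW.isOpen hWV
    fun _ hx hxW => hW.ne (hV.closure_subset hx) hxW

theorem IsolatingNhd.degree_eq {f : Euc k → Euc k} {U V : Set (Euc k)} {y : Euc k}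
    (hV : IsolatingNhd f U y V) (hf : ContinuousOn f U) :
    degree f U y = admissibleDegree f V y := by
  obtain ⟨W, hW, hd⟩ := Classical.epsilon_spec
    (p := fun d : ℤ => ∃ V, IsolatingNhd f U y V ∧ d = admissibleDegree f V y) ⟨_, V, hV, rfl⟩
  refine hd.trans ?_
  -- Two isolating neighbourhoods are compared through their intersection, by excision.
  rw [hW.admissibleDegree_eq_of_subset (hW.inter hV) hf inter_subset_left,
    hV.admissibleDegree_eq_of_subset (hW.inter hV) hf inter_subset_right]

theorem exists_bounded_nhd {K U : Set (Euc k)} (hK : IsCompact K) (hU : IsOpen U) (hKU : K ⊆ U) :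
    ∃ V, IsOpen V ∧ Bornology.IsBounded V ∧ K ⊆ V ∧ closure V ⊆ U := by
  obtain ⟨L, hL, hKL, hLU⟩ := exists_compact_between hK hU hKU
  exact ⟨interior L, isOpen_interior, hL.isBounded.subset interior_subset, hKL,
    (closure_minimal interior_subset hL.isClosed).trans hLU⟩

theorem WeaklyAdmissible.exists_isolatingNhd {f : Euc k → Euc k} {U : Set (Euc k)} {y : Euc k}
    (h : WeaklyAdmissible f U y) : ∃ V, IsolatingNhd f U y V := by
  obtain ⟨V, hV, hVb, hKV, hVU⟩ := exists_bounded_nhd h.isCompact h.isOpen inter_subset_left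
  exact ⟨V, hV, hVb, hKV, hVU⟩

theorem WeaklyAdmissible.left {f : Euc k → Euc k} {U U₁ U₂ : Set (Euc k)} {y : Euc k}
    (h : WeaklyAdmissible f U y) (h₁ : IsOpen U₁) (h₂ : IsOpen U₂) (hU₁ : U₁ ⊆ U)
    (hd : Disjoint U₁ U₂) (hy : U ∩ f ⁻¹' {y} ⊆ U₁ ∪ U₂) : WeaklyAdmissible f U₁ y := by
  refine ⟨h₁, h.continuousOn.mono hU₁, ?_⟩
  have : U₁ ∩ f ⁻¹' {y} = (U ∩ f ⁻¹' {y}) \ U₂ := by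
    ext x
    exact ⟨fun hx => ⟨⟨hU₁ hx.1, hx.2⟩, fun h => hd.le_bot ⟨hx.1, h⟩⟩,
      fun hx => ⟨(hy hx.1).resolve_right hx.2, hx.1.2⟩⟩
  rw [this]
  exact h.isCompact.diff h₂

theorem WeaklyAdmissible.degree_add {f : Euc k → Euc k} {U U₁ U₂ : Set (Euc k)} {y : Euc k}
    (h : WeaklyAdmissible f U y) (h₁ : WeaklyAdmissible f U₁ y) (h₂ : WeaklyAdmissible f U₂ y)
    (hU₁ : U₁ ⊆ U) (hU₂ : U₂ ⊆ U) (hd : Disjoint U₁ U₂) (hy : U ∩ f ⁻¹' {y} ⊆ U₁ ∪ U₂) :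
    degree f U y = degree f U₁ y + degree f U₂ y := by
  obtain ⟨V₁, hV₁⟩ := h₁.exists_isolatingNhd
  obtain ⟨V₂, hV₂⟩ := h₂.exists_isolatingNhd
  have hV : IsolatingNhd f U y (V₁ ∪ V₂) := by
    refine ⟨hV₁.isOpen.union hV₂.isOpen, hV₁.isBounded.union hV₂.isBounded, fun x hx => ?_, ?_⟩
    · exact (hy hx).imp (fun h => hV₁.subset ⟨h, hx.2⟩) (fun h => hV₂.subset ⟨h, hx.2⟩)
    · rw [closure_union]
      exact union_subset (hV₁.closure_subset.trans hU₁) (hV₂.closure_subset.trans hU₂)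
  rw [hV.degree_eq h.continuousOn, hV₁.degree_eq h₁.continuousOn, hV₂.degree_eq h₂.continuousOn]
  exact admissibleDegree_add hV.isOpen hV.isBounded (h.continuousOn.mono hV.closure_subset)
    hV₁.isOpen hV₂.isOpen subset_union_left subset_union_right
    (hd.mono (subset_closure.trans hV₁.closure_subset) (subset_closure.trans hV₂.closure_subset))
    fun x hx hxV => hV.ne (hV.closure_subset hx) hxV

/-! ### Homotopy invariance. -/

/-- An approximation of a triple also approximates all triples that are close enough to it. -/
theorem Approximates.exists_of_close {f g : Euc k → Euc k} {V : Set (Euc k)} {y z : Euc k}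
    (h : Approximates g z f V y) : ∃ η > 0, ∀ (f' : Euc k → Euc k) (y' : Euc k),
      (∀ x ∈ closure V, ‖f' x - f x‖ ≤ η) → ‖y - y'‖ ≤ η → Approximates g z f' V y' := by
  obtain ⟨hr, ε, σ, hε, hσ, hf, hz, hd⟩ := h
  obtain ⟨c, hc, hF⟩ := (ofReal_lt_infEDist_iff (by positivity)).1 hd
  -- Moving `f` and `y` by `η` raises `ε + σ` by `2η` and lowers `c` by `2η`, so `4η` must stay
  -- below the gap `c - (ε + σ)`.
  have hη : 0 < (c - (ε + σ)) / 8 := by linarith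
  refine ⟨(c - (ε + σ)) / 8, hη, fun f' y' hf' hy' => ⟨hr, ε + (c - (ε + σ)) / 8,
    σ + (c - (ε + σ)) / 8, by positivity, by positivity, fun x hx => ?_, ?_,
    (ofReal_lt_infEDist_iff (by positivity)).2 ⟨c - 2 * ((c - (ε + σ)) / 8), by linarith,
      fun x hx => ?_⟩⟩⟩
  · have := norm_add_le (f' x - f x) (f x - g x)
    rw [sub_add_sub_cancel] at this
    linarith [hf' x hx, hf x hx]
  · have := norm_add_le (z - y) (y - y')
    rw [sub_add_sub_cancel] at this
    linarith
  · have h1 := norm_sub_le (f' x - y') ((f' x - f x) + (y - y'))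
    have h2 := norm_add_le (f' x - f x) (y - y')
    rw [show f' x - y' - ((f' x - f x) + (y - y')) = f x - y by abel] at h1
    linarith [hf' x (frontier_subset_closure hx), hF x hx]

theorem WeaklyAdmissibleHomotopy.weaklyAdmissible {H : Euc k × ℝ → Euc k} {U : Set (Euc k)}
    {α : ℝ → Euc k} (h : WeaklyAdmissibleHomotopy H U α) {t : ℝ} (ht : t ∈ Icc (0 : ℝ) 1) :
    WeaklyAdmissible (fun x => H (x, t)) U (α t) := by
  refine ⟨h.isOpen, h.continuousOn.comp (by fun_prop) fun x hx => ⟨hx, ht⟩, ?_⟩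
  have h1 := (h.isCompact.inter_right (isClosed_singleton.preimage
    (continuous_snd : Continuous (Prod.snd : Euc k × ℝ → ℝ)) (t := {t}))).image continuous_fst
  convert h1 using 1
  ext x
  constructor
  · rintro ⟨hx, hxt⟩
    exact ⟨(x, t), ⟨⟨⟨hx, ht⟩, hxt⟩, rfl⟩, rfl⟩
  · rintro ⟨⟨x, s⟩, ⟨⟨⟨hx, -⟩, hxt⟩, hs⟩, rfl⟩
    obtain rfl : s = t := hs
    exact ⟨hx, hxt⟩

theorem WeaklyAdmissibleHomotopy.degree_eq {H : Euc k × ℝ → Euc k} {U : Set (Euc k)}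
    {α : ℝ → Euc k} (h : WeaklyAdmissibleHomotopy H U α) :
    degree (fun x => H (x, 0)) U (α 0) = degree (fun x => H (x, 1)) U (α 1) := by
  -- The projection of the solution set to `U` is compact, so a single `V` isolates the solutions
  -- for all parameters.
  obtain ⟨V, hV, hVb, hKV, hVU⟩ := exists_bounded_nhd (h.isCompact.image continuous_fst) h.isOpen
    (by rintro _ ⟨p, hp, rfl⟩; exact hp.1.1)
  have hiso : ∀ t ∈ Icc (0 : ℝ) 1, IsolatingNhd (fun x => H (x, t)) U (α t) V := fun t ht =>
    ⟨hV, hVb, fun x hx => hKV ⟨(x, t), ⟨⟨hx.1, ht⟩, hx.2⟩, rfl⟩, hVU⟩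
  have hcont : ContinuousOn (fun t => admissibleDegree (fun x => H (x, t)) V (α t))
      (Icc (0 : ℝ) 1) := by
    intro s hs
    obtain ⟨g, z, hg⟩ := ((hiso s hs).admissible
      (h.weaklyAdmissible hs).continuousOn).exists_approximates hVb
    obtain ⟨η, hη, hclose⟩ := hg.exists_of_close
    have huc := ((hVb.isCompact_closure.prod isCompact_Icc).uniformContinuousOn_of_continuous
      (h.continuousOn.mono (prod_mono_left hVU)))
    obtain ⟨δ, hδ, hHδ⟩ := Metric.uniformContinuousOn_iff.1 huc η hη
    have hα : ∀ᶠ t in 𝓝[Icc (0 : ℝ) 1] s, dist (α t) (α s) < η :=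
      (h.continuousOn_path s hs).eventually (Metric.ball_mem_nhds _ hη)
    have hst : ∀ᶠ t in 𝓝[Icc (0 : ℝ) 1] s, dist t s < δ :=
      mem_nhdsWithin_of_mem_nhds (Metric.ball_mem_nhds s hδ)
    -- The approximation chosen at `s` still approximates at nearby `t`, so the degree equals
    -- `regularDegree g V z` near `s`.
    refine (continuousWithinAt_const (b := regularDegree g V z)).congr_of_eventuallyEq ?_
      (hg.admissibleDegree_eq hVb)
    filter_upwards [hα, hst, self_mem_nhdsWithin] with t h1 h2 ht
    refine (hclose _ _ (fun x hx => ?_) ?_).admissibleDegree_eq hVb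
    · rw [← dist_eq_norm]
      exact (hHδ (x, t) ⟨hx, ht⟩ (x, s) ⟨hx, hs⟩ (by simpa [Prod.dist_eq] using h2)).le
    · rw [← dist_eq_norm, dist_comm]; exact h1.le
  have h0 : (0 : ℝ) ∈ Icc (0 : ℝ) 1 := by simp
  have h1 : (1 : ℝ) ∈ Icc (0 : ℝ) 1 := by simp
  rw [(hiso 0 h0).degree_eq (h.weaklyAdmissible h0).continuousOn,
    (hiso 1 h1).degree_eq (h.weaklyAdmissible h1).continuousOn]
  exact isPreconnected_Icc.constant hcont h0 h1

/-! ### Normalization. -/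

theorem weaklyAdmissible_id : WeaklyAdmissible (id : Euc k → Euc k) univ 0 :=
  ⟨isOpen_univ, continuousOn_id, by simp⟩

theorem degree_id : degree (id : Euc k → Euc k) univ 0 = 1 := by
  have hiso : IsolatingNhd (id : Euc k → Euc k) univ 0 (Metric.ball 0 1) :=
    ⟨Metric.isOpen_ball, Metric.isBounded_ball, by simp, subset_univ _⟩
  have hid : ∀ x : Euc k, fderiv ℝ (id : Euc k → Euc k) x = ContinuousLinearMap.id ℝ (Euc k) :=
    fun x => fderiv_id
  have happ : Approximates id 0 (id : Euc k → Euc k) (Metric.ball 0 1) 0 := by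
    refine ⟨⟨hiso.admissible continuousOn_id, ?_, fun x _ _ => ?_⟩, 1 / 4, 1 / 4, by norm_num,
      by norm_num, by simp, by simp, (ofReal_lt_infEDist_iff (by norm_num)).2
        ⟨1, by norm_num, fun x hx => ?_⟩⟩
    · exact ⟨univ, id, isOpen_univ, subset_univ _, contDiff_id.contDiffOn, fun _ _ => rfl⟩
    · rw [hid]; exact Function.surjective_id
    · rw [Metric.isOpen_ball.frontier_eq] at hx
      simpa using hx.2
  rw [hiso.degree_eq continuousOn_id, happ.admissibleDegree_eq Metric.isBounded_ball,
    regularDegree]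
  have : Metric.ball (0 : Euc k) 1 ∩ id ⁻¹' {0} = {0} := by
    ext x
    simp only [preimage_id, mem_inter_iff, mem_singleton_iff, and_iff_right_iff_imp]
    rintro rfl
    simp
  have hdet : (ContinuousLinearMap.id ℝ (Euc k)).det = 1 := LinearMap.det_id
  rw [this, finsum_mem_singleton, index, hid, hdet]
  simp

end Degree

end BrouwerDegree

end

theorem mainTheorem12 (k : ℕ) :
    -- Well-posedness: the degree exists and does not depend on the choices in its definition.
    (∀ (f : BrouwerDegree.Euc k → BrouwerDegree.Euc k) (U : Set (BrouwerDegree.Euc k))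
        (y : BrouwerDegree.Euc k), BrouwerDegree.WeaklyAdmissible f U y →
      (∃ V, BrouwerDegree.IsolatingNhd f U y V) ∧
      ∀ V, BrouwerDegree.IsolatingNhd f U y V →
        BrouwerDegree.Admissible f V y ∧
        BrouwerDegree.degree f U y = BrouwerDegree.admissibleDegree f V y ∧
        (∃ g z, BrouwerDegree.Approximates g z f V y) ∧
        ∀ g z, BrouwerDegree.Approximates g z f V y →
          (V ∩ g ⁻¹' {z}).Finite ∧
          BrouwerDegree.admissibleDegree f V y = BrouwerDegree.regularDegree g V z) ∧
    -- Normalization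
    (BrouwerDegree.WeaklyAdmissible (id : BrouwerDegree.Euc k → BrouwerDegree.Euc k)
        Set.univ 0 ∧
      BrouwerDegree.degree (id : BrouwerDegree.Euc k → BrouwerDegree.Euc k) Set.univ 0 = 1) ∧
    -- Additivity
    (∀ (f : BrouwerDegree.Euc k → BrouwerDegree.Euc k) (U U₁ U₂ : Set (BrouwerDegree.Euc k))
        (y : BrouwerDegree.Euc k), BrouwerDegree.WeaklyAdmissible f U y →
      IsOpen U₁ → IsOpen U₂ → U₁ ⊆ U → U₂ ⊆ U → Disjoint U₁ U₂ →
      U ∩ f ⁻¹' {y} ⊆ U₁ ∪ U₂ →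
        BrouwerDegree.WeaklyAdmissible f U₁ y ∧ BrouwerDegree.WeaklyAdmissible f U₂ y ∧
        BrouwerDegree.degree f U y =
          BrouwerDegree.degree f U₁ y + BrouwerDegree.degree f U₂ y) ∧
    -- Homotopy Invariance
    (∀ (H : BrouwerDegree.Euc k × ℝ → BrouwerDegree.Euc k) (U : Set (BrouwerDegree.Euc k))
        (α : ℝ → BrouwerDegree.Euc k), BrouwerDegree.WeaklyAdmissibleHomotopy H U α →
        BrouwerDegree.WeaklyAdmissible (fun x => H (x, 0)) U (α 0) ∧
        BrouwerDegree.WeaklyAdmissible (fun x => H (x, 1)) U (α 1) ∧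
        BrouwerDegree.degree (fun x => H (x, 0)) U (α 0) =
          BrouwerDegree.degree (fun x => H (x, 1)) U (α 1)) := by
  open BrouwerDegree in
  refine ⟨fun f U y h => ⟨h.exists_isolatingNhd, fun V hV => ?_⟩, ⟨weaklyAdmissible_id, degree_id⟩,
    fun f U U₁ U₂ y h h₁ h₂ hU₁ hU₂ hd hy => ?_,
    fun H U α h => ⟨h.weaklyAdmissible (by simp), h.weaklyAdmissible (by simp), h.degree_eq⟩⟩
  · have ha := hV.admissible h.continuousOn
    exact ⟨ha, hV.degree_eq h.continuousOn, ha.exists_approximates hV.isBounded,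
      fun g z hg => ⟨hg.1.finite hV.isBounded, hg.admissibleDegree_eq hV.isBounded⟩⟩
  · have hw₁ := h.left h₁ h₂ hU₁ hd hy
    have hw₂ := h.left h₂ h₁ hU₂ hd.symm (by rwa [union_comm])
    exact ⟨hw₁, hw₂, h.degree_add hw₁ hw₂ hU₁ hU₂ hd hy⟩
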